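/- Let $\Omega$ be a finite set of states and $X$ a mixture space of consequences. An act is a map $f:\Omega\to X$, a menu is a nonempty finite set of acts, and $\succsim$ is a binary relation on menus, with $F\sim G$ meaning $F\succsim G$ and $G\succsim F$. Write $\Delta(\Omega)$ for the simplex of probabilities on $\Omega$ and, for $p_0\in\Delta(\Omega)$, write $\Pi(p_0)$ for the set of finitely supported probability distributions $\pi$ on $\Delta(\Omega)$ with $\int p\,d\pi(p)=p_0$. The relation $\succsim$ is *represented* by $(u,p_0,c)$, where $u:X\to\mathbb R$ is affine and surjective, $p_0\in\Delta(\Omega)$ and $c:\Pi(p_0)\to\mathbb R\cup\{\infty\}$, if for every menu $F$ the maximum $$V(F)=\max_{\pi\in\Pi(p_0)}\Big(\int \phi_F\,d\pi-c(\pi)\Big)\in\mathbb R,\qquad \phi_F(p)=\max_{f\in F}\sum_{\omega}u(f(\omega))p(\omega),$$ exists, and $F\succsim G\iff V(F)\ge V(G)$ for all menus $F,G$. It is *rationally inattentive* if it is represented by some $(u,p_0,c)$. It satisfies *IIA* if, whenever $F\cap G\neq\emptyset$ and $F\sim F\cap G\sim G$, then $F\sim F\cup G$; it satisfies *IE* if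 for every menu $F$ there is an act $h$ with $\{h\}\sim F\sim F\cup\{h\}$. It has a *posterior-separable representation* $(u,p_0,\psi)$ if it is represented by $(u,p_0,c)$ with $c(\pi)=\int\psi\,d\pi$ for all $\pi\in\Pi(p_0)$, where $\psi:\Delta(\Omega)\to\mathbb R\cup\{\infty\}$ is a canonical measure of uncertainty: $\psi$ is convex, $\psi\ge 0$, $\psi(p_0)=0$, and $p_0$ lies in the relative interior of $\operatorname{dom}\psi=\{\psi<\infty\}$. Given such a $\psi$, let $T$ be a bijective affine map from the affine hull of $\operatorname{dom}\psi$ onto $\mathbb R^M$ (the properties below do not depend on the choice of $T$), and write $\bar p=T(p)$. * $\psi$ satisfies the *unique hyperplane property (UHP)* if for every menu $F$ there is exactly one $\lambda\in\mathbb R^M$ such that $\phi_F(p)-\psi(p)\le\lambda\cdot(\bar p-\bar p_0)+V(F)$ for all $p\in\operatorname{dom}\psi$. * For $p\in\operatorname{dom}\psi$ let $\partial\bar\psi(\bar p)=\{\lambda\in\mathbb R^M:\lambda\cdot(\bar q-\bar p)\le\psi(q)-\psi(p)\ \ \forall q\in\operatorname{dom}\psi\}$. Then $\psi$ satisfies *joint-directional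 differentiability (JDD)* if there do not exist $\delta\in\mathbb R^M\setminus\{0\}$, points $p_1,\dots,p_K\in\operatorname{dom}\psi$ with $p_0\in\operatorname{co}\{p_1,\dots,p_K\}$, and vectors $\lambda_1,\dots,\lambda_K\in\mathbb R^M$ such that, for every $i$, $\lambda_i\in\partial\bar\psi(\bar p_i)$, $\lambda_i+\delta\in\partial\bar\psi(\bar p_i)$ and $\delta\cdot(\bar p_i-\bar p_0)=0$. **Theorem.** The following statements are equivalent: 1. $\succsim$ is rationally inattentive and satisfies IIA and IE. 2. $\succsim$ has a posterior-separable representation $(u,p_0,\psi)$ such that $\psi$ satisfies JDD. 3. $\succsim$ has a posterior-separable representation $(u,p_0,\psi)$ such that $\psi$ satisfies UHP. -/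

import Mathlib

noncomputable section

/-! ## Acts, menus and preferences -/

/-- A mixture space (Herstein–Milnor): `mix a x y` is the mixture `a x + (1 - a) y`, `a ∈ [0, 1]`. -/
class MixtureSpace (X : Type*) where
  mix : unitInterval → X → X → X
  mix_one : ∀ x y, mix 1 x y = x
  mix_comm : ∀ a x y, mix a x y = mix (unitInterval.symm a) y x
  mix_mix : ∀ a b x y, mix a (mix b x y) y = mix (a * b) x y

/-- A menu: a nonempty finite set of acts `Ω → X`. -/
@[ext]
structure Menu (Ω X : Type*) where
  acts : Finset (Ω → X)
  nonempty : acts.Nonempty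

namespace Menu

variable {Ω X : Type*}

/-- The menu with a single act. -/
def single (f : Ω → X) : Menu Ω X := ⟨{f}, Finset.singleton_nonempty f⟩

open Classical in
/-- The union of two menus. -/
def union (F G : Menu Ω X) : Menu Ω X := ⟨F.acts ∪ G.acts, F.nonempty.inl⟩

open Classical in
/-- The intersection of two menus that share an act. -/
def inter (F G : Menu Ω X) (h : (F.acts ∩ G.acts).Nonempty) : Menu Ω X := ⟨F.acts ∩ G.acts, h⟩

end Menu

/-- Indifference. -/
def Indiff {Ω X : Type*} (pref : Menu Ω X → Menu Ω X → Prop) (F G : Menu Ω X) : Prop :=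
  pref F G ∧ pref G F

open Classical in
/-- Independence of Irrelevant Alternatives: if `F ∼ F ∩ G ∼ G` then `F ∼ F ∪ G`. -/
def IIA {Ω X : Type*} (pref : Menu Ω X → Menu Ω X → Prop) : Prop :=
  ∀ (F G : Menu Ω X) (h : (F.acts ∩ G.acts).Nonempty),
    Indiff pref F (F.inter G h) → Indiff pref (F.inter G h) G → Indiff pref F (F.union G)

/-- Ignorance Equivalence: every menu `F` has an act `h` with `h ∼ F ∼ F ∪ h`. -/
def IE {Ω X : Type*} (pref : Menu Ω X → Menu Ω X → Prop) : Prop :=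
  ∀ F : Menu Ω X, ∃ h : Ω → X,
    Indiff pref (Menu.single h) F ∧ Indiff pref F (F.union (Menu.single h))

section

variable {Ω X : Type*} [Fintype Ω]

/-! ## Rational inattention -/

/-- `φ_F(p) = max_{f ∈ F} ∑_ω u(f(ω)) p(ω)`. -/
def menuUtility (u : X → ℝ) (F : Menu Ω X) (p : stdSimplex ℝ Ω) : ℝ :=
  F.acts.sup' F.nonempty fun f => ∑ ω, u (f ω) * p.1 ω

/-- `Π(p₀)`: the finitely supported distributions over posteriors whose mean is the prior. -/
def feasible (p₀ : stdSimplex ℝ Ω) : Set (Convexity.StdSimplex ℝ (stdSimplex ℝ Ω)) :=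
  {π | ∀ ω, ∑ p ∈ π.weights.support, π.weights p * p.1 ω = p₀.1 ω}

/-- `∫ φ dπ` for a real-valued `φ`. -/
def integralReal (φ : stdSimplex ℝ Ω → ℝ) (π : Convexity.StdSimplex ℝ (stdSimplex ℝ Ω)) : ℝ :=
  ∑ p ∈ π.weights.support, π.weights p * φ p

/-- `∫ ψ dπ` for an extended-real-valued `ψ`. -/
def integralEReal (ψ : stdSimplex ℝ Ω → EReal) (π : Convexity.StdSimplex ℝ (stdSimplex ℝ Ω)) : EReal :=
  ∑ p ∈ π.weights.support, (π.weights p : EReal) * ψ p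

/-- The preference is represented by the utility `u`, the prior `p₀` and the cost of information
`c : Π(p₀) → ℝ ∪ {∞}`, with value `V(F) = max_{π ∈ Π(p₀)} ∫ φ_F dπ - c(π)`. -/
structure Represents [MixtureSpace X] (pref : Menu Ω X → Menu Ω X → Prop) (u : X → ℝ)
    (p₀ : stdSimplex ℝ Ω) (c : feasible p₀ → EReal) (V : Menu Ω X → ℝ) : Prop where
  affine : ∀ (a : unitInterval) (x y : X),
    u (MixtureSpace.mix a x y) = (a : ℝ) * u x + (1 - (a : ℝ)) * u y
  surjective : Function.Surjective u
  cost_ne_bot : ∀ π, c π ≠ ⊥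
  isMax : ∀ F, IsGreatest
    (Set.range fun π : feasible p₀ => ((integralReal (menuUtility u F) π.1 : ℝ) : EReal) - c π)
    ((V F : ℝ) : EReal)
  pref_iff : ∀ F G, pref F G ↔ V G ≤ V F

/-- A rationally inattentive preference. -/
def RationallyInattentive [MixtureSpace X] (pref : Menu Ω X → Menu Ω X → Prop) : Prop :=
  ∃ (u : X → ℝ) (p₀ : stdSimplex ℝ Ω) (c : feasible p₀ → EReal) (V : Menu Ω X → ℝ),
    Represents pref u p₀ c V

/-! ## Posterior-separable costs -/

/-- The effective domain of `ψ`, as a subset of `ℝ^Ω`. -/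
def effDom (ψ : stdSimplex ℝ Ω → EReal) : Set (Ω → ℝ) :=
  Subtype.val '' {p | ψ p < ⊤}

/-- `ψ : Δ(Ω) → ℝ ∪ {∞}` is a canonical measure of uncertainty for the prior `p₀`. -/
structure IsCanonical (ψ : stdSimplex ℝ Ω → EReal) (p₀ : stdSimplex ℝ Ω) : Prop where
  convex : ∀ (p q r : stdSimplex ℝ Ω) (a b : ℝ), 0 ≤ a → 0 ≤ b → a + b = 1 →
    r.1 = a • p.1 + b • q.1 → ψ r ≤ (a : EReal) * ψ p + (b : EReal) * ψ q
  grounded : ψ p₀ = 0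
  nonneg : ∀ p, 0 ≤ ψ p
  prior_mem : p₀.1 ∈ intrinsicInterior ℝ (effDom ψ)

/-- The preference has a posterior-separable representation `(u, p₀, c)`, `c(π) = ∫ ψ dπ`, where
`ψ` is a canonical measure of uncertainty; `V` is the value of menus. -/
structure PosteriorSeparable [MixtureSpace X] (pref : Menu Ω X → Menu Ω X → Prop) (u : X → ℝ)
    (p₀ : stdSimplex ℝ Ω) (ψ : stdSimplex ℝ Ω → EReal) (V : Menu Ω X → ℝ) : Prop where
  represents : Represents pref u p₀ (fun π => integralEReal ψ π.1) V
  canonical : IsCanonical ψ p₀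

/-- A bijective affine map `T` from the affine hull of `dom ψ` onto `ℝ^M`. (An affine map on an
affine subspace of `ℝ^Ω` is the restriction of one on `ℝ^Ω`.) -/
structure DomainChart (ψ : stdSimplex ℝ Ω → EReal) (M : ℕ) where
  T : (Ω → ℝ) →ᵃ[ℝ] (Fin M → ℝ)
  bijOn : Set.BijOn T (affineSpan ℝ (effDom ψ) : Set (Ω → ℝ)) Set.univ

/-- Such a map exists, so that quantifying over all of them below is not vacuous. -/
theorem exists_domainChart (ψ : stdSimplex ℝ Ω → EReal) (h : (effDom ψ).Nonempty) :
    ∃ M, Nonempty (DomainChart ψ M) := by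
  obtain ⟨p, hp⟩ := h
  have hpA : p ∈ affineSpan ℝ (effDom ψ) := subset_affineSpan ℝ _ hp
  set A := affineSpan ℝ (effDom ψ)
  obtain ⟨g, hg⟩ := A.direction.subtype.exists_leftInverse_of_injective
    (Submodule.ker_subtype _)
  have hg' : ∀ v : A.direction, g v = v := fun v => LinearMap.congr_fun hg v
  let e := (Module.finBasis ℝ A.direction).equivFun
  refine ⟨Module.finrank ℝ A.direction, ⟨⟨(e.toLinearMap ∘ₗ g).toAffineMap.comp
    (AffineMap.id ℝ (Ω → ℝ) - AffineMap.const ℝ (Ω → ℝ) p), fun _ _ => trivial, ?_, ?_⟩⟩⟩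
  · intro x hx y hy hxy
    have hx' : x - p ∈ A.direction := A.vsub_mem_direction hx hpA
    have hy' : y - p ∈ A.direction := A.vsub_mem_direction hy hpA
    have h1 : g (x - p) = g (y - p) := e.injective (by simpa using hxy)
    have h2 := hg' ⟨x - p, hx'⟩
    have h3 := hg' ⟨y - p, hy'⟩
    simp only at h2 h3
    rw [h2, h3] at h1
    simpa using congrArg Subtype.val h1
  · intro z _
    refine ⟨(e.symm z : Ω → ℝ) + p, ?_, ?_⟩
    · exact A.vadd_mem_of_mem_direction (e.symm z).2 hpA
    · simp [hg']

/-- `Λ_F`: the slopes `l` of the hyperplanes `l · (y - T p₀) + V(F)` that lie above the net utility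
`N_F = φ_F - ψ` at every `y = T p`, `p ∈ dom ψ`. -/
def optimalSlopes (u : X → ℝ) (p₀ : stdSimplex ℝ Ω) (ψ : stdSimplex ℝ Ω → EReal)
    (V : Menu Ω X → ℝ) {M : ℕ} (τ : DomainChart ψ M) (F : Menu Ω X) : Set (Fin M → ℝ) :=
  {l | ∀ p : stdSimplex ℝ Ω, ψ p < ⊤ →
    ((menuUtility u F p : ℝ) : EReal) - ψ p ≤ ((l ⬝ᵥ (τ.T p.1 - τ.T p₀.1) + V F : ℝ) : EReal)}

/-- The unique hyperplane property. -/
def UHP (u : X → ℝ) (p₀ : stdSimplex ℝ Ω) (ψ : stdSimplex ℝ Ω → EReal)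
    (V : Menu Ω X → ℝ) : Prop :=
  ∀ (M : ℕ) (τ : DomainChart ψ M) (F : Menu Ω X), ∃ l, optimalSlopes u p₀ ψ V τ F = {l}

/-- The subdifferential at `T p`, `p ∈ dom ψ`, of the translation of `ψ` to `ℝ^M`. -/
def subdiff (ψ : stdSimplex ℝ Ω → EReal) {M : ℕ} (τ : DomainChart ψ M)
    (p : stdSimplex ℝ Ω) : Set (Fin M → ℝ) :=
  {l | ∀ q : stdSimplex ℝ Ω, ψ q < ⊤ →
    ((l ⬝ᵥ (τ.T q.1 - τ.T p.1) : ℝ) : EReal) ≤ ψ q - ψ p}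

/-- The translation of `ψ` is non-differentiable in the direction `δ` at the points `T (p i)`. -/
def NonDiffInDirection (p₀ : stdSimplex ℝ Ω) (ψ : stdSimplex ℝ Ω → EReal) {M : ℕ}
    (τ : DomainChart ψ M) (δ : Fin M → ℝ) {K : ℕ} (p : Fin K → stdSimplex ℝ Ω) : Prop :=
  ∃ l : Fin K → (Fin M → ℝ), ∀ i,
    l i ∈ subdiff ψ τ (p i) ∧ l i + δ ∈ subdiff ψ τ (p i) ∧
      δ ⬝ᵥ (τ.T (p i).1 - τ.T p₀.1) = 0

/-- Joint-directional differentiability. -/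
def JDD (p₀ : stdSimplex ℝ Ω) (ψ : stdSimplex ℝ Ω → EReal) : Prop :=
  ∀ (M : ℕ) (τ : DomainChart ψ M),
    ¬ ∃ (δ : Fin M → ℝ) (K : ℕ) (p : Fin K → stdSimplex ℝ Ω), δ ≠ 0 ∧ (∀ i, ψ (p i) < ⊤) ∧
      p₀.1 ∈ convexHull ℝ (Set.range fun i => (p i).1) ∧ NonDiffInDirection p₀ ψ τ δ p

end

end

/-!
The easy directions go through hyperplanes that lie above the net utility `φ_F - ψ` of a menu and
pass through `V(F)` at the prior. Such a hyperplane is the utility of an act, and this act is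
ignorance equivalent to `F`; hence IE (`indiff_of_mem_optimalSlopes`). Adding acts without raising
the value only shrinks the set of slopes, so when slopes are unique, `F`, `G` and `F ∩ G` in the
premise of IIA share theirs, which then bounds the value of `F ∪ G` (`iia_of_uhp`). Under any
posterior-separable representation a slope exists, by the Riesz extension theorem and because the
prior is relatively interior to `dom ψ` (`optimalSlopes_nonempty`). At the posteriors of an optimal
distribution for `F` all hyperplanes touch the net utility, so two slopes differ by a direction in
which `ψ` is jointly non-differentiable there; thus JDD gives UHP (`uhp_of_jdd`).

For the remaining direction, call a gain `x ∈ ℝ^Ω` worthless if `{h, h + x} ∼ {h}` for an act `h`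
(equivalently for all), and let `ψ` be the support function of the set of worthless gains. If `h`
is ignorance equivalent to `F`, every `f - h` with `f ∈ F` is worthless, so `φ_F - ψ ≤ h` and no
distribution achieves more than `V(F)`. By IIA, adding `h + x` to `F ∪ {h}`, for a worthless gain
`x`, does not raise the value; so at the posteriors of an optimal distribution for `F` under the
original cost these acts do not beat `F`, that is, `φ_F - ψ = h` there, and the same distribution
achieves `V(F)` under the cost `∫ ψ dπ` (`represents_revealedUncertainty`). The worthless gains
with prior mean zero form a group by IIA, and a support function that is finite at `q` forces a
group to vanish at `q` (`dotProduct_eq_zero_of_mem`). A failure of JDD in a direction `δ` would make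
`-δ` a nonzero element of this group (`jdd_revealedUncertainty`), and a prior outside the relative
interior of `dom ψ` would make all multiples of a nonnegative nonzero gain worthless
(`prior_mem_intrinsicInterior`).
-/

/-! ### Integrals against finitely supported distributions -/

section Integral

variable {Ω : Type*} [Fintype Ω]

theorem integralReal_mono {φ χ : stdSimplex ℝ Ω → ℝ}
    {π : Convexity.StdSimplex ℝ (stdSimplex ℝ Ω)}
    (h : ∀ p ∈ π.weights.support, φ p ≤ χ p) : integralReal φ π ≤ integralReal χ π :=
  Finset.sum_le_sum fun p hp => mul_le_mul_of_nonneg_left (h p hp) (π.weights_nonneg p)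

theorem integralReal_add (φ χ : stdSimplex ℝ Ω → ℝ)
    (π : Convexity.StdSimplex ℝ (stdSimplex ℝ Ω)) :
    integralReal (fun p => φ p + χ p) π = integralReal φ π + integralReal χ π := by
  simp only [integralReal, mul_add, Finset.sum_add_distrib]

theorem integralReal_sub (φ χ : stdSimplex ℝ Ω → ℝ)
    (π : Convexity.StdSimplex ℝ (stdSimplex ℝ Ω)) :
    integralReal (fun p => φ p - χ p) π = integralReal φ π - integralReal χ π := by
  simp only [integralReal, mul_sub, Finset.sum_sub_distrib]

/-- Bayes plausibility: a linear function integrates to its value at the prior. -/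
theorem integralReal_linear {p₀ : stdSimplex ℝ Ω} {π : Convexity.StdSimplex ℝ (stdSimplex ℝ Ω)}
    (hπ : π ∈ feasible p₀) (x : Ω → ℝ) :
    integralReal (fun p => x ⬝ᵥ p.1) π = x ⬝ᵥ p₀.1 := by
  simp only [integralReal, dotProduct, Finset.mul_sum]
  rw [Finset.sum_comm]
  refine Finset.sum_congr rfl fun ω _ => ?_
  rw [← hπ ω, Finset.mul_sum]
  exact Finset.sum_congr rfl fun p _ => by ring

/-- A function that is dominated on the support by one with the same integral agrees with it
there. -/
theorem eq_of_integralReal_le {φ χ : stdSimplex ℝ Ω → ℝ}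
    {π : Convexity.StdSimplex ℝ (stdSimplex ℝ Ω)}
    (h : ∀ p ∈ π.weights.support, φ p ≤ χ p) (hle : integralReal χ π ≤ integralReal φ π)
    {p : stdSimplex ℝ Ω} (hp : p ∈ π.weights.support) : φ p = χ p := by
  have h1 : ∀ p ∈ π.weights.support, π.weights p * φ p ≤ π.weights p * χ p :=
    fun p hp => mul_le_mul_of_nonneg_left (h p hp) (π.weights_nonneg p)
  exact mul_left_cancel₀ (Finsupp.mem_support_iff.1 hp)
    ((Finset.sum_eq_sum_iff_of_le h1).1 (le_antisymm (integralReal_mono h) hle) p hp)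

theorem integralEReal_coe (φ : stdSimplex ℝ Ω → ℝ)
    (π : Convexity.StdSimplex ℝ (stdSimplex ℝ Ω)) :
    integralEReal (fun p => (φ p : EReal)) π = ((integralReal φ π : ℝ) : EReal) := by
  have hcoe : ∀ g : stdSimplex ℝ Ω → ℝ,
      ∑ p ∈ π.weights.support, (g p : EReal) = ((∑ p ∈ π.weights.support, g p : ℝ) : EReal) :=
    fun g => (map_sum (⟨⟨Real.toEReal, rfl⟩, EReal.coe_add⟩ : ℝ →+ EReal) g _).symm
  exact hcoe fun p => π.weights p * φ p

theorem integralEReal_congr {ψ χ : stdSimplex ℝ Ω → EReal}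
    {π : Convexity.StdSimplex ℝ (stdSimplex ℝ Ω)}
    (h : ∀ p ∈ π.weights.support, ψ p = χ p) : integralEReal ψ π = integralEReal χ π :=
  Finset.sum_congr rfl fun p hp => by rw [h p hp]

theorem integralEReal_mono {ψ χ : stdSimplex ℝ Ω → EReal}
    {π : Convexity.StdSimplex ℝ (stdSimplex ℝ Ω)}
    (h : ∀ p ∈ π.weights.support, ψ p ≤ χ p) : integralEReal ψ π ≤ integralEReal χ π :=
  Finset.sum_le_sum fun p hp =>
    mul_le_mul_of_nonneg_left (h p hp) (EReal.coe_nonneg.2 (π.weights_nonneg p))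

theorem integralEReal_nonneg {ψ : stdSimplex ℝ Ω → EReal} (hψ : ∀ p, 0 ≤ ψ p)
    (π : Convexity.StdSimplex ℝ (stdSimplex ℝ Ω)) : 0 ≤ integralEReal ψ π :=
  Finset.sum_nonneg fun p _ => mul_nonneg (EReal.coe_nonneg.2 (π.weights_nonneg p)) (hψ p)

/-- A distribution of finite cost is supported in the effective domain. -/
theorem lt_top_of_integralEReal_ne_top {ψ : stdSimplex ℝ Ω → EReal} (hψ : ∀ p, 0 ≤ ψ p)
    {π : Convexity.StdSimplex ℝ (stdSimplex ℝ Ω)} (h : integralEReal ψ π ≠ ⊤)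
    {p : stdSimplex ℝ Ω} (hp : p ∈ π.weights.support) : ψ p < ⊤ := by
  by_contra hlt
  refine h (top_le_iff.1 ?_)
  have h1 : (π.weights p : EReal) * ψ p ≤ integralEReal ψ π :=
    Finset.single_le_sum (f := fun p => (π.weights p : EReal) * ψ p)
      (fun p _ => mul_nonneg (EReal.coe_nonneg.2 (π.weights_nonneg p)) (hψ p)) hp
  rwa [not_lt_top_iff.1 hlt, EReal.coe_mul_top_of_pos
    (lt_of_le_of_ne (π.weights_nonneg p) (Finsupp.mem_support_iff.1 hp).symm)] at h1

theorem coe_toReal_of_nonneg {a : EReal} (h0 : 0 ≤ a) (h : a < ⊤) : (a.toReal : EReal) = a :=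
  EReal.coe_toReal h.ne (ne_bot_of_le_ne_bot (by simp) h0)

theorem integralEReal_eq_toReal {ψ : stdSimplex ℝ Ω → EReal} (hψ : ∀ p, 0 ≤ ψ p)
    {π : Convexity.StdSimplex ℝ (stdSimplex ℝ Ω)} (h : ∀ p ∈ π.weights.support, ψ p < ⊤) :
    integralEReal ψ π = ((integralReal (fun p => (ψ p).toReal) π : ℝ) : EReal) := by
  rw [← integralEReal_coe]
  exact integralEReal_congr fun p hp => (coe_toReal_of_nonneg (hψ p) (h p hp)).symm

/-- A finite convex combination of posteriors equal to the prior is the barycenter of a feasible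
distribution. -/
theorem exists_feasible_of_sum {ι : Type*} {p₀ : stdSimplex ℝ Ω} (t : Finset ι) (w : ι → ℝ)
    (P : ι → stdSimplex ℝ Ω) (hw : ∀ i ∈ t, 0 ≤ w i) (hsum : ∑ i ∈ t, w i = 1)
    (hp₀ : ∑ i ∈ t, w i • (P i).1 = p₀.1) :
    ∃ π ∈ feasible p₀, (∀ φ, integralReal φ π = ∑ i ∈ t, w i * φ (P i)) ∧
      ∀ p ∈ π.weights.support, ∃ i ∈ t, P i = p := by
  classical
  have hint : ∀ φ : stdSimplex ℝ Ω → ℝ,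
      (∑ i ∈ t, Finsupp.single (P i) (w i)).sum (fun p r => r * φ p) = ∑ i ∈ t, w i * φ (P i) := by
    intro φ
    rw [← Finsupp.sum_finsetSum_index (by simp) (by intros; ring)]
    exact Finset.sum_congr rfl fun i _ => Finsupp.sum_single_index (by simp)
  let π : Convexity.StdSimplex ℝ (stdSimplex ℝ Ω) :=
    { weights := ∑ i ∈ t, Finsupp.single (P i) (w i)
      nonneg := Finset.sum_nonneg fun i hi => by simpa using hw i hi
      total := by simpa [hsum] using hint fun _ => 1 }
  refine ⟨π, fun ω => ?_, hint, fun p hp => ?_⟩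
  · refine (hint fun p => p.1 ω).trans ?_
    rw [← hp₀]
    simp
  · obtain ⟨i, hi, hpi⟩ := Finset.mem_biUnion.1 (Finsupp.support_finsetSum hp)
    exact ⟨i, hi, (Finset.mem_singleton.1 (Finsupp.support_single_subset hpi)).symm⟩

end Integral

/-! ### Charts of the effective domain -/

theorem linearMap_eq_dotProduct {ι : Type*} [Fintype ι] [DecidableEq ι] (f : (ι → ℝ) →ₗ[ℝ] ℝ)
    (v : ι → ℝ) : f v = (fun j => f (Pi.single j 1)) ⬝ᵥ v := by
  conv_lhs => rw [pi_eq_sum_univ' v, map_sum]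
  exact Finset.sum_congr rfl fun i _ => by rw [map_smul, smul_eq_mul, mul_comm]

namespace DomainChart

variable {Ω : Type*} [Fintype Ω] {ψ : stdSimplex ℝ Ω → EReal} {M : ℕ}

/-- The chart as an affine equivalence from the affine hull of the domain onto `ℝ^M`. -/
noncomputable def equiv (τ : DomainChart ψ M) [Nonempty (affineSpan ℝ (effDom ψ))] :
    affineSpan ℝ (effDom ψ) ≃ᵃ[ℝ] (Fin M → ℝ) :=
  AffineEquiv.ofBijective (φ := τ.T.comp (affineSpan ℝ (effDom ψ)).subtype)
    ⟨fun p q h => Subtype.ext (τ.bijOn.injOn p.2 q.2 h), fun z => by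
      obtain ⟨p, hp, rfl⟩ := τ.bijOn.surjOn (Set.mem_univ z)
      exact ⟨⟨p, hp⟩, rfl⟩⟩

/-- In the chart, a linear function on `ℝ^Ω` becomes affine: this is its slope. -/
theorem exists_slope (τ : DomainChart ψ M) (h : (effDom ψ).Nonempty) (x : Ω → ℝ) :
    ∃ μ : Fin M → ℝ, ∀ p ∈ affineSpan ℝ (effDom ψ), ∀ q ∈ affineSpan ℝ (effDom ψ),
      μ ⬝ᵥ (τ.T p - τ.T q) = x ⬝ᵥ p - x ⬝ᵥ q := by
  have : Nonempty (affineSpan ℝ (effDom ψ)) := (h.mono (subset_affineSpan ℝ _)).to_subtype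
  let L : (Fin M → ℝ) →ᵃ[ℝ] ℝ := (dotProductBilin ℝ ℝ x).toAffineMap.comp
    ((affineSpan ℝ (effDom ψ)).subtype.comp τ.equiv.symm.toAffineMap)
  refine ⟨fun j => L.linear (Pi.single j 1), fun p hp q hq => ?_⟩
  have hL : ∀ p (hp : p ∈ affineSpan ℝ (effDom ψ)), L (τ.T p) = x ⬝ᵥ p := by
    intro p hp
    have : τ.equiv.symm (τ.T p) = ⟨p, hp⟩ := by
      rw [AffineEquiv.symm_apply_eq]; rfl
    simp [L, this]
  rw [← hL p hp, ← hL q hq, ← vsub_eq_sub (L _), ← L.linearMap_vsub, vsub_eq_sub,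
    ← linearMap_eq_dotProduct L.linear]

/-- On the simplex, an affine function of the chart coordinates is linear, hence the expected
utility of an act. -/
theorem exists_dotProduct_eq (T : (Ω → ℝ) →ᵃ[ℝ] (Fin M → ℝ)) (l z : Fin M → ℝ) (k : ℝ) :
    ∃ x : Ω → ℝ, ∀ p : stdSimplex ℝ Ω, x ⬝ᵥ p.1 = l ⬝ᵥ (T p.1 - z) + k := by
  classical
  let f : (Ω → ℝ) →ₗ[ℝ] ℝ := (dotProductBilin ℝ ℝ l).comp T.linear
  refine ⟨(fun ω => f (Pi.single ω 1)) + fun _ => l ⬝ᵥ (T 0 - z) + k, fun p => ?_⟩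
  have h1 : T p.1 - z = T.linear p.1 + (T 0 - z) := by
    have := T.linearMap_vsub p.1 0
    simp only [vsub_eq_sub, sub_zero] at this
    rw [this]
    abel
  have h2 : (fun _ : Ω => l ⬝ᵥ (T 0 - z) + k) ⬝ᵥ p.1 = l ⬝ᵥ (T 0 - z) + k := by
    rw [dotProduct, ← Finset.mul_sum, p.2.2, mul_one]
  rw [add_dotProduct, ← linearMap_eq_dotProduct, h2, h1, dotProduct_add, add_assoc]
  rfl

theorem mem_intrinsicInterior_iff (τ : DomainChart ψ M) {p : Ω → ℝ}
    (hp : p ∈ affineSpan ℝ (effDom ψ)) :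
    p ∈ intrinsicInterior ℝ (effDom ψ) ↔ τ.T p ∈ interior (τ.T '' effDom ψ) := by
  have : Nonempty (affineSpan ℝ (effDom ψ)) := ⟨⟨p, hp⟩⟩
  let e := (AffineEquiv.toContinuousAffineEquiv (𝕜 := ℝ)
    (E := (affineSpan ℝ (effDom ψ)).direction) (F := Fin M → ℝ) (PE := affineSpan ℝ (effDom ψ))
    (PF := Fin M → ℝ) τ.equiv).toHomeomorph
  have he : e '' ((↑) ⁻¹' effDom ψ) = τ.T '' effDom ψ := by
    ext z
    constructor
    · rintro ⟨q, hq, rfl⟩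
      exact ⟨q, hq, rfl⟩
    · rintro ⟨q, hq, rfl⟩
      exact ⟨⟨q, subset_affineSpan ℝ _ hq⟩, hq, rfl⟩
  rw [← he, ← e.image_interior, mem_intrinsicInterior]
  constructor
  · rintro ⟨y, hy, rfl⟩
    exact ⟨y, hy, rfl⟩
  · rintro ⟨y, hy, hyp⟩
    exact ⟨y, hy, τ.bijOn.injOn y.2 hp hyp⟩

theorem affineSpan_image_eq_top (τ : DomainChart ψ M) :
    affineSpan ℝ (τ.T '' effDom ψ) = ⊤ := by
  rw [← AffineSubspace.map_span]
  refine SetLike.coe_injective ?_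
  rw [AffineSubspace.coe_map, τ.bijOn.image_eq, AffineSubspace.top_coe]

/-- A slope that is constant on the domain vanishes. -/
theorem eq_zero_of_dotProduct_eq_zero (τ : DomainChart ψ M) {p₀ : Ω → ℝ} {δ : Fin M → ℝ}
    (h : ∀ p ∈ effDom ψ, δ ⬝ᵥ (τ.T p - τ.T p₀) = 0) : δ = 0 := by
  have hle : affineSpan ℝ (τ.T '' effDom ψ) ≤
      AffineSubspace.mk' (τ.T p₀) (LinearMap.ker (dotProductBilin ℝ ℝ δ)) := by
    rw [affineSpan_le]
    rintro _ ⟨p, hp, rfl⟩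
    rw [SetLike.mem_coe, AffineSubspace.mem_mk']
    exact h p hp
  rw [τ.affineSpan_image_eq_top] at hle
  have h1 := hle (AffineSubspace.mem_top ℝ _ (δ + τ.T p₀))
  rw [AffineSubspace.mem_mk'] at h1
  simpa [dotProduct_self_eq_zero] using h1

/-- Points of the domain are reached from a relatively interior point in every direction. -/
theorem exists_mem_effDom_eq_add_smul (τ : DomainChart ψ M) {p₀ : Ω → ℝ}
    (hp₀ : p₀ ∈ intrinsicInterior ℝ (effDom ψ)) (v : Fin M → ℝ) :
    ∃ ε > 0, ∃ p : stdSimplex ℝ Ω, ψ p < ⊤ ∧ τ.T p.1 - τ.T p₀ = (ε : ℝ) • v := by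
  rw [τ.mem_intrinsicInterior_iff (subset_affineSpan ℝ _ (intrinsicInterior_subset hp₀)),
    mem_interior_iff_mem_nhds] at hp₀
  have hcont : Filter.Tendsto (fun ε : ℝ => τ.T p₀ + ε • v) (nhds 0) (nhds (τ.T p₀)) := by
    have : Continuous fun ε : ℝ => τ.T p₀ + ε • v := by fun_prop
    simpa using this.tendsto 0
  obtain ⟨ε, ⟨_, ⟨p, hp, rfl⟩, hε⟩, hpos⟩ :=
    (((hcont.mono_left nhdsWithin_le_nhds).eventually hp₀).and
      (self_mem_nhdsWithin (s := Set.Ioi (0 : ℝ)))).exists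
  exact ⟨ε, hpos, p, hp, by rw [hε]; abel⟩

/-- A point of a convex effective domain outside its relative interior is separated from it by a
nontrivial supporting hyperplane. -/
theorem exists_supporting_slope (τ : DomainChart ψ M) (hconv : Convex ℝ (effDom ψ)) {p₀ : Ω → ℝ}
    (hp₀ : p₀ ∈ effDom ψ) (hint : p₀ ∉ intrinsicInterior ℝ (effDom ψ)) :
    ∃ l : Fin M → ℝ, (∀ p ∈ effDom ψ, 0 ≤ l ⬝ᵥ (τ.T p - τ.T p₀)) ∧
      ∃ q ∈ effDom ψ, 0 < l ⬝ᵥ (τ.T q - τ.T p₀) := by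
  have hconv' : Convex ℝ (τ.T '' effDom ψ) := hconv.affine_image τ.T
  rw [τ.mem_intrinsicInterior_iff (subset_affineSpan ℝ _ hp₀)] at hint
  obtain ⟨y, hy⟩ := hconv'.interior_nonempty_iff_affineSpan_eq_top.2 τ.affineSpan_image_eq_top
  obtain ⟨g, hg⟩ := geometric_hahn_banach_point_open hconv'.interior isOpen_interior hint
  have hgl : ∀ v : Fin M → ℝ, (fun j => g (Pi.single j 1)) ⬝ᵥ v = g v :=
    fun v => (linearMap_eq_dotProduct g.toLinearMap v).symm
  refine ⟨fun j => g (Pi.single j 1), fun p hp => ?_, ?_⟩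
  · rw [hgl, map_sub, sub_nonneg]
    have hcl : τ.T '' effDom ψ ⊆ {z | g (τ.T p₀) ≤ g z} := by
      refine subset_closure.trans ?_
      rw [← hconv'.closure_interior_eq_closure_of_nonempty_interior ⟨y, hy⟩]
      exact closure_minimal (fun z hz => (hg z hz).le)
        (isClosed_le continuous_const g.continuous)
    exact hcl ⟨p, hp, rfl⟩
  · obtain ⟨q, hq, rfl⟩ := interior_subset hy
    refine ⟨q, hq, ?_⟩
    rw [hgl, map_sub, sub_pos]
    exact hg _ hy

end DomainChart

/-! ### Menus and their values -/

theorem Menu.mem_single {Ω X : Type*} {f g : Ω → X} : g ∈ (Menu.single f).acts ↔ g = f :=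
  Finset.mem_singleton

theorem Menu.mem_union {Ω X : Type*} {F G : Menu Ω X} {f : Ω → X} :
    f ∈ (F.union G).acts ↔ f ∈ F.acts ∨ f ∈ G.acts := by
  classical
  exact Finset.mem_union

theorem Menu.mem_inter {Ω X : Type*} {F G : Menu Ω X} {f : Ω → X} {h} :
    f ∈ (F.inter G h).acts ↔ f ∈ F.acts ∧ f ∈ G.acts := by
  classical
  exact Finset.mem_inter

/-- IIA with the intersection of the menus as an explicit menu. -/
theorem IIA.exists_inter {Ω X : Type*} {pref : Menu Ω X → Menu Ω X → Prop} (hI : IIA pref)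
    {F G H : Menu Ω X} (hF : H.acts ⊆ F.acts) (hG : H.acts ⊆ G.acts) :
    ∃ J : Menu Ω X, (∀ g, g ∈ J.acts ↔ g ∈ F.acts ∧ g ∈ G.acts) ∧
      (Indiff pref F J → Indiff pref J G → Indiff pref F (F.union G)) := by
  classical
  obtain ⟨f, hf⟩ := H.nonempty
  exact ⟨F.inter G ⟨f, Finset.mem_inter.2 ⟨hF hf, hG hf⟩⟩, fun _ => Menu.mem_inter, hI F G _⟩

theorem exists_act {Ω X : Type*} {u : X → ℝ} (hu : Function.Surjective u) (x : Ω → ℝ) :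
    ∃ f : Ω → X, u ∘ f = x :=
  ⟨Function.surjInv hu ∘ x, funext fun ω => Function.surjInv_eq hu (x ω)⟩

section MenuUtility

variable {Ω X : Type*} [Fintype Ω] {u : X → ℝ} {F G : Menu Ω X} {p : stdSimplex ℝ Ω}

theorem le_menuUtility {f : Ω → X} (hf : f ∈ F.acts) : (u ∘ f) ⬝ᵥ p.1 ≤ menuUtility u F p :=
  Finset.le_sup' (fun f => (u ∘ f) ⬝ᵥ p.1) hf

theorem menuUtility_le {a : ℝ} (h : ∀ f ∈ F.acts, (u ∘ f) ⬝ᵥ p.1 ≤ a) : menuUtility u F p ≤ a :=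
  Finset.sup'_le _ _ h

theorem exists_menuUtility_eq (u : X → ℝ) (F : Menu Ω X) (p : stdSimplex ℝ Ω) :
    ∃ f ∈ F.acts, menuUtility u F p = (u ∘ f) ⬝ᵥ p.1 :=
  Finset.exists_mem_eq_sup' F.nonempty fun f => (u ∘ f) ⬝ᵥ p.1

theorem menuUtility_single (f : Ω → X) : menuUtility u (Menu.single f) p = (u ∘ f) ⬝ᵥ p.1 :=
  le_antisymm (menuUtility_le fun g hg => by rw [Menu.mem_single.1 hg])
    (le_menuUtility (Menu.mem_single.2 rfl))

theorem menuUtility_mono (h : F.acts ⊆ G.acts) : menuUtility u F p ≤ menuUtility u G p :=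
  menuUtility_le fun _ hf => le_menuUtility (h hf)

theorem menuUtility_union_le {a : ℝ} (hF : menuUtility u F p ≤ a) (hG : menuUtility u G p ≤ a) :
    menuUtility u (F.union G) p ≤ a :=
  menuUtility_le fun _ hf => (Menu.mem_union.1 hf).elim
    (fun h => (le_menuUtility h).trans hF) (fun h => (le_menuUtility h).trans hG)

end MenuUtility

namespace Represents

variable {Ω X : Type*} [Fintype Ω] [MixtureSpace X] {pref : Menu Ω X → Menu Ω X → Prop}
  {u : X → ℝ} {p₀ : stdSimplex ℝ Ω} {c : feasible p₀ → EReal} {V : Menu Ω X → ℝ}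

/-- An optimal distribution for `F` has a finite cost, and is available for every other menu. -/
theorem exists_optimal (R : Represents pref u p₀ c V) (F : Menu Ω X) :
    ∃ (π : feasible p₀) (r : ℝ), c π = r ∧ integralReal (menuUtility u F) π.1 - r = V F ∧
      ∀ G, integralReal (menuUtility u G) π.1 - r ≤ V G := by
  obtain ⟨π, hπ⟩ := (R.isMax F).1
  have hbot := R.cost_ne_bot π
  simp only at hπ
  induction hc : c π with
  | bot => exact absurd hc hbot
  | top => simp [hc] at hπ
  | coe r =>
    rw [hc, ← EReal.coe_sub, EReal.coe_eq_coe_iff] at hπ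
    refine ⟨π, r, hc, hπ, fun G => ?_⟩
    have := (R.isMax G).2 ⟨π, rfl⟩
    simp only at this
    rwa [hc, ← EReal.coe_sub, EReal.coe_le_coe_iff] at this

/-- Monotonicity and translation covariance of the value. -/
theorem value_le_value_add (R : Represents pref u p₀ c V) {F G : Menu Ω X} (x : Ω → ℝ)
    (h : ∀ p : stdSimplex ℝ Ω, menuUtility u F p ≤ menuUtility u G p + x ⬝ᵥ p.1) :
    V F ≤ V G + x ⬝ᵥ p₀.1 := by
  obtain ⟨π, r, -, hF, hG⟩ := R.exists_optimal F
  have h1 : integralReal (menuUtility u F) π.1 ≤ integralReal (menuUtility u G) π.1 + x ⬝ᵥ p₀.1 := by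
    rw [← integralReal_linear π.2 x, ← integralReal_add]
    exact integralReal_mono fun p _ => h p
  linarith [hG G]

theorem value_mono (R : Represents pref u p₀ c V) {F G : Menu Ω X} (h : F.acts ⊆ G.acts) :
    V F ≤ V G := by
  simpa using R.value_le_value_add (F := F) (G := G) 0
    fun p => by simpa using menuUtility_mono h

theorem value_single_le_of_mem (R : Represents pref u p₀ c V) {F : Menu Ω X} {f : Ω → X}
    (hf : f ∈ F.acts) : V (Menu.single f) ≤ V F :=
  R.value_mono fun _ hg => Menu.mem_single.1 hg ▸ hf

theorem value_single_eq (R : Represents pref u p₀ c V) (f h : Ω → X) :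
    V (Menu.single f) = V (Menu.single h) + (u ∘ f) ⬝ᵥ p₀.1 - (u ∘ h) ⬝ᵥ p₀.1 := by
  have key : ∀ f h : Ω → X,
      V (Menu.single f) ≤ V (Menu.single h) + (u ∘ f - u ∘ h) ⬝ᵥ p₀.1 := fun f h =>
    R.value_le_value_add _ fun p => by
      rw [menuUtility_single, menuUtility_single, sub_dotProduct]
      linarith
  have h1 := key f h
  have h2 := key h f
  rw [sub_dotProduct] at h1 h2
  linarith

theorem indiff_iff (R : Represents pref u p₀ c V) {F G : Menu Ω X} :
    Indiff pref F G ↔ V F = V G := by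
  rw [Indiff, R.pref_iff, R.pref_iff, and_comm]
  exact le_antisymm_iff.symm

/-- IIA, for two menus that add no value to a common submenu. -/
theorem value_union_le (R : Represents pref u p₀ c V) (hI : IIA pref) {F G H : Menu Ω X}
    (hHF : H.acts ⊆ F.acts) (hHG : H.acts ⊆ G.acts) (hF : V F ≤ V H) (hG : V G ≤ V H) :
    V (F.union G) ≤ V H := by
  obtain ⟨J, hJ, hI⟩ := hI.exists_inter hHF hHG
  have h1 : V H ≤ V J := R.value_mono fun g hg => (hJ g).2 ⟨hHF hg, hHG hg⟩
  have h2 : V J ≤ V F := R.value_mono fun g hg => ((hJ g).1 hg).1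
  have h3 : V J ≤ V G := R.value_mono fun g hg => ((hJ g).1 hg).2
  have h4 := R.indiff_iff.1 (hI (R.indiff_iff.2 (by linarith)) (R.indiff_iff.2 (by linarith)))
  linarith

end Represents

section EReal

variable {Ω X : Type*} [Fintype Ω] {u : X → ℝ} {p₀ : stdSimplex ℝ Ω}
  {ψ : stdSimplex ℝ Ω → EReal} {V : Menu Ω X → ℝ}

theorem mem_optimalSlopes_iff (hψ : ∀ p, 0 ≤ ψ p) {M : ℕ} (τ : DomainChart ψ M) {F : Menu Ω X}
    {l : Fin M → ℝ} : l ∈ optimalSlopes u p₀ ψ V τ F ↔ ∀ p : stdSimplex ℝ Ω, ψ p < ⊤ →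
      menuUtility u F p - (ψ p).toReal ≤ l ⬝ᵥ (τ.T p.1 - τ.T p₀.1) + V F := by
  refine forall_congr' fun p => forall_congr' fun hp => ?_
  rw [← EReal.coe_le_coe_iff, EReal.coe_sub, coe_toReal_of_nonneg (hψ p) hp]

theorem mem_subdiff_iff (hψ : ∀ p, 0 ≤ ψ p) {M : ℕ} (τ : DomainChart ψ M) {p : stdSimplex ℝ Ω}
    (hp : ψ p < ⊤) {l : Fin M → ℝ} : l ∈ subdiff ψ τ p ↔ ∀ q : stdSimplex ℝ Ω, ψ q < ⊤ →
      l ⬝ᵥ (τ.T q.1 - τ.T p.1) ≤ (ψ q).toReal - (ψ p).toReal := by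
  refine forall_congr' fun q => forall_congr' fun hq => ?_
  rw [← EReal.coe_le_coe_iff, EReal.coe_sub, coe_toReal_of_nonneg (hψ p) hp,
    coe_toReal_of_nonneg (hψ q) hq]

end EReal

/-! ### Values under a posterior-separable cost -/

section Separable

variable {Ω X : Type*} [Fintype Ω] [MixtureSpace X] {pref : Menu Ω X → Menu Ω X → Prop}
  {u : X → ℝ} {p₀ : stdSimplex ℝ Ω} {ψ : stdSimplex ℝ Ω → EReal} {V : Menu Ω X → ℝ}

namespace Represents

theorem exists_optimal_separable
    (R : Represents pref u p₀ (fun π => integralEReal ψ π.1) V) (hψ : ∀ p, 0 ≤ ψ p)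
    (F : Menu Ω X) :
    ∃ π ∈ feasible p₀, (∀ p ∈ π.weights.support, ψ p < ⊤) ∧
      integralReal (menuUtility u F) π - integralReal (fun p => (ψ p).toReal) π = V F := by
  obtain ⟨π, r, hr, hF, -⟩ := R.exists_optimal F
  have hsupp : ∀ p ∈ π.1.weights.support, ψ p < ⊤ := fun p hp =>
    lt_top_of_integralEReal_ne_top hψ (by simp [hr]) hp
  refine ⟨π.1, π.2, hsupp, ?_⟩
  rw [integralEReal_eq_toReal hψ hsupp, EReal.coe_eq_coe_iff] at hr
  rw [hr, hF]

theorem integral_sub_le_value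
    (R : Represents pref u p₀ (fun π => integralEReal ψ π.1) V) (hψ : ∀ p, 0 ≤ ψ p)
    (F : Menu Ω X) {π} (hπ : π ∈ feasible p₀) (hsupp : ∀ p ∈ π.weights.support, ψ p < ⊤) :
    integralReal (menuUtility u F) π - integralReal (fun p => (ψ p).toReal) π ≤ V F := by
  have := (R.isMax F).2 ⟨⟨π, hπ⟩, rfl⟩
  simp only at this
  rwa [integralEReal_eq_toReal hψ hsupp, ← EReal.coe_sub, EReal.coe_le_coe_iff] at this

/-- If a linear function lies above the net utility of `F`, its value at the prior bounds the value
of `F`. -/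
theorem value_le_of_net_le
    (R : Represents pref u p₀ (fun π => integralEReal ψ π.1) V) (hψ : ∀ p, 0 ≤ ψ p)
    {F : Menu Ω X} (x : Ω → ℝ)
    (h : ∀ p, ψ p < ⊤ → menuUtility u F p - (ψ p).toReal ≤ x ⬝ᵥ p.1) : V F ≤ x ⬝ᵥ p₀.1 := by
  obtain ⟨π, hπ, hsupp, hF⟩ := R.exists_optimal_separable hψ F
  rw [← hF, ← integralReal_sub, ← integralReal_linear hπ x]
  exact integralReal_mono fun p hp => h p (hsupp p hp)

/-- The net utility of a menu, averaged over a finite decomposition of the prior, is at most the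
value of the menu. -/
theorem sum_net_le_value
    (R : Represents pref u p₀ (fun π => integralEReal ψ π.1) V) (hψ : ∀ p, 0 ≤ ψ p)
    (F : Menu Ω X) {ι : Type*} (t : Finset ι) (w : ι → ℝ) (P : ι → stdSimplex ℝ Ω)
    (hw : ∀ i ∈ t, 0 ≤ w i) (hsum : ∑ i ∈ t, w i = 1) (hp₀ : ∑ i ∈ t, w i • (P i).1 = p₀.1)
    (hP : ∀ i ∈ t, ψ (P i) < ⊤) :
    ∑ i ∈ t, w i * (menuUtility u F (P i) - (ψ (P i)).toReal) ≤ V F := by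
  obtain ⟨π, hπ, hint, hsupp⟩ := exists_feasible_of_sum t w P hw hsum hp₀
  have := R.integral_sub_le_value hψ F hπ fun p hp => by
    obtain ⟨i, hi, rfl⟩ := hsupp p hp
    exact hP i hi
  rwa [← integralReal_sub, hint] at this

theorem net_prior_le_value
    (R : Represents pref u p₀ (fun π => integralEReal ψ π.1) V) (hψ : ∀ p, 0 ≤ ψ p)
    (h₀ : ψ p₀ = 0) (F : Menu Ω X) : menuUtility u F p₀ ≤ V F := by
  simpa [h₀] using R.sum_net_le_value hψ F {()} (fun _ => 1) (fun _ => p₀) (by simp) (by simp)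
    (by simp) (by simp [h₀])

theorem value_single_eq_dotProduct
    (R : Represents pref u p₀ (fun π => integralEReal ψ π.1) V) (hψ : ∀ p, 0 ≤ ψ p)
    (h₀ : ψ p₀ = 0) (f : Ω → X) : V (Menu.single f) = (u ∘ f) ⬝ᵥ p₀.1 := by
  refine le_antisymm (R.value_le_of_net_le hψ _ fun p _ => ?_) ?_
  · rw [menuUtility_single]
    linarith [EReal.toReal_nonneg (hψ p)]
  · rw [← menuUtility_single]
    exact R.net_prior_le_value hψ h₀ _

end Represents

end Separable

/-! ### Hyperplanes above the net utility -/

namespace PosteriorSeparable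

variable {Ω X : Type*} [Fintype Ω] [MixtureSpace X] {pref : Menu Ω X → Menu Ω X → Prop}
  {u : X → ℝ} {p₀ : stdSimplex ℝ Ω} {ψ : stdSimplex ℝ Ω → EReal} {V : Menu Ω X → ℝ}

theorem prior_mem_effDom (P : PosteriorSeparable pref u p₀ ψ V) : p₀.1 ∈ effDom ψ :=
  intrinsicInterior_subset P.canonical.prior_mem

theorem rationallyInattentive (P : PosteriorSeparable pref u p₀ ψ V) :
    RationallyInattentive pref :=
  ⟨u, p₀, _, V, P.represents⟩

/-- The act whose utility is a hyperplane above the net utility of `F` is ignorance equivalent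
to `F`. -/
theorem indiff_of_mem_optimalSlopes (P : PosteriorSeparable pref u p₀ ψ V) {M : ℕ}
    (τ : DomainChart ψ M) {F : Menu Ω X} {l : Fin M → ℝ}
    (hl : l ∈ optimalSlopes u p₀ ψ V τ F) :
    ∃ h : Ω → X, Indiff pref (Menu.single h) F ∧ Indiff pref F (F.union (Menu.single h)) := by
  have hψ := P.canonical.nonneg
  obtain ⟨x, hx⟩ := DomainChart.exists_dotProduct_eq τ.T l (τ.T p₀.1) (V F)
  obtain ⟨h, rfl⟩ := exists_act P.represents.surjective x
  have hp₀ : (u ∘ h) ⬝ᵥ p₀.1 = V F := by simpa using hx p₀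
  refine ⟨h, P.represents.indiff_iff.2 ?_, P.represents.indiff_iff.2 (le_antisymm
    (P.represents.value_mono fun f hf => Menu.mem_union.2 (Or.inl hf)) ?_)⟩
  · rw [P.represents.value_single_eq_dotProduct hψ P.canonical.grounded, hp₀]
  · rw [← hp₀]
    refine P.represents.value_le_of_net_le hψ _ fun p hp => ?_
    have h1 := (mem_optimalSlopes_iff hψ τ).1 hl p hp
    rw [sub_le_iff_le_add]
    refine menuUtility_union_le ?_ ?_
    · linarith [hx p]
    · rw [menuUtility_single]
      linarith [EReal.toReal_nonneg (hψ p)]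

theorem ie_of_uhp (P : PosteriorSeparable pref u p₀ ψ V) (hU : UHP u p₀ ψ V) : IE pref := by
  intro F
  obtain ⟨M, ⟨τ⟩⟩ := exists_domainChart ψ ⟨_, P.prior_mem_effDom⟩
  obtain ⟨l, hl⟩ := hU M τ F
  exact P.indiff_of_mem_optimalSlopes τ (hl ▸ Set.mem_singleton l)

/-- Enlarging a menu without raising its value can only remove optimal slopes, so that under UHP
three menus as in the premise of IIA have the same slope, which serves the union. -/
theorem iia_of_uhp (P : PosteriorSeparable pref u p₀ ψ V) (hU : UHP u p₀ ψ V) : IIA pref := by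
  intro F G hne hF hG
  have hψ := P.canonical.nonneg
  obtain ⟨M, ⟨τ⟩⟩ := exists_domainChart ψ ⟨_, P.prior_mem_effDom⟩
  have hVF := P.represents.indiff_iff.1 hF
  have hVG := P.represents.indiff_iff.1 hG
  obtain ⟨l, hl⟩ := hU M τ (F.inter G hne)
  have key : ∀ F' : Menu Ω X, (F.inter G hne).acts ⊆ F'.acts → V F' = V (F.inter G hne) →
      l ∈ optimalSlopes u p₀ ψ V τ F' := by
    intro F' hsub hV
    obtain ⟨l', hl'⟩ := hU M τ F'
    have hmem : l' ∈ optimalSlopes u p₀ ψ V τ F' := hl' ▸ Set.mem_singleton l'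
    have hmem' : l' ∈ optimalSlopes u p₀ ψ V τ (F.inter G hne) := by
      rw [mem_optimalSlopes_iff hψ] at hmem ⊢
      intro p hp
      rw [← hV]
      linarith [hmem p hp, menuUtility_mono (u := u) (p := p) hsub]
    rw [hl, Set.mem_singleton_iff] at hmem'
    rwa [← hmem']
  have hlF := (mem_optimalSlopes_iff hψ τ).1 (key F (fun _ h => (Menu.mem_inter.1 h).1) hVF)
  have hlG := (mem_optimalSlopes_iff hψ τ).1 (key G (fun _ h => (Menu.mem_inter.1 h).2) hVG.symm)
  obtain ⟨x, hx⟩ := DomainChart.exists_dotProduct_eq τ.T l (τ.T p₀.1) (V F)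
  refine P.represents.indiff_iff.2 (le_antisymm
    (P.represents.value_mono fun f hf => Menu.mem_union.2 (Or.inl hf)) ?_)
  have hp₀ : x ⬝ᵥ p₀.1 = V F := by simpa using hx p₀
  rw [← hp₀]
  refine P.represents.value_le_of_net_le hψ x fun p hp => ?_
  rw [sub_le_iff_le_add]
  exact menuUtility_union_le (by linarith [hlF p hp, hx p]) (by linarith [hlG p hp, hx p])

/-- Weighted displacements `p - p₀` that cancel in the chart decompose the prior, so the weighted
net utilities cannot exceed the value of the menu. -/
theorem sum_net_le_of_sum_eq_zero (P : PosteriorSeparable pref u p₀ ψ V) {M : ℕ}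
    (τ : DomainChart ψ M) (F : Menu Ω X) (t : Finset (stdSimplex ℝ Ω)) (r : stdSimplex ℝ Ω → ℝ)
    (hr : ∀ p ∈ t, 0 ≤ r p) (ht : ∀ p ∈ t, ψ p < ⊤)
    (h : ∑ p ∈ t, r p • (τ.T p.1 - τ.T p₀.1) = 0) :
    0 ≤ ∑ p ∈ t, r p * (V F - (menuUtility u F p - (ψ p).toReal)) := by
  rcases (Finset.sum_nonneg hr).eq_or_lt with h0 | hpos
  · have hz := (Finset.sum_eq_zero_iff_of_nonneg hr).1 h0.symm
    exact (Finset.sum_eq_zero fun p hp => by rw [hz p hp, zero_mul]).ge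
  set R := ∑ p ∈ t, r p with hR
  have hw : ∀ p ∈ t, 0 ≤ r p / R := fun p hp => div_nonneg (hr p hp) hpos.le
  have hsum : ∑ p ∈ t, r p / R = 1 := by rw [← Finset.sum_div, ← hR, div_self hpos.ne']
  have hmem : ∑ p ∈ t, (r p / R) • p.1 ∈ affineSpan ℝ (effDom ψ) :=
    (AffineSubspace.convex (affineSpan ℝ (effDom ψ))).sum_mem hw hsum
      fun p hp => subset_affineSpan ℝ _ ⟨p, ht p hp, rfl⟩
  have hdiff : ∑ p ∈ t, (r p / R) • p.1 - p₀.1 = ∑ p ∈ t, (r p / R) • (p.1 - p₀.1) := by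
    simp only [smul_sub, Finset.sum_sub_distrib]
    rw [← Finset.sum_smul, hsum, one_smul]
  have hmean : ∑ p ∈ t, (r p / R) • p.1 = p₀.1 := by
    refine τ.bijOn.injOn hmem (subset_affineSpan ℝ _ P.prior_mem_effDom) (sub_eq_zero.1 ?_)
    rw [← vsub_eq_sub, ← τ.T.linearMap_vsub, vsub_eq_sub, hdiff, map_sum,
      ← smul_zero R⁻¹, ← h, Finset.smul_sum]
    refine Finset.sum_congr rfl fun p _ => ?_
    rw [map_smul, ← vsub_eq_sub p.1, τ.T.linearMap_vsub, vsub_eq_sub, smul_smul, div_eq_inv_mul]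
  have hle := P.represents.sum_net_le_value P.canonical.nonneg F t (fun p => r p / R) id hw hsum
    hmean ht
  simp only [id] at hle
  have h1 : ∑ p ∈ t, r p * (V F - (menuUtility u F p - (ψ p).toReal)) =
      R * (V F - ∑ p ∈ t, r p / R * (menuUtility u F p - (ψ p).toReal)) := by
    rw [mul_sub, Finset.mul_sum, hR, Finset.sum_mul, ← Finset.sum_sub_distrib, ← hR]
    exact Finset.sum_congr rfl fun p _ => by field_simp
  rw [h1]
  exact mul_nonneg hpos.le (sub_nonneg.2 hle)

/-- The cone generated by the points `(T p - T p₀, V(F) - N_F(p))`, `p ∈ dom ψ`, and the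
upward vertical direction. -/
def netCone (u : X → ℝ) (p₀ : stdSimplex ℝ Ω) (ψ : stdSimplex ℝ Ω → EReal) (V : Menu Ω X → ℝ)
    {M : ℕ} (τ : DomainChart ψ M) (F : Menu Ω X) : PointedCone ℝ ((Fin M → ℝ) × ℝ) where
  carrier := {z | ∃ r : stdSimplex ℝ Ω →₀ ℝ, 0 ≤ r ∧ (∀ p, r p ≠ 0 → ψ p < ⊤) ∧
    Finsupp.linearCombination ℝ (fun p : stdSimplex ℝ Ω => τ.T p.1 - τ.T p₀.1) r = z.1 ∧
    Finsupp.linearCombination ℝ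
      (fun p : stdSimplex ℝ Ω => V F - (menuUtility u F p - (ψ p).toReal)) r ≤ z.2}
  zero_mem' := ⟨0, le_rfl, by simp, by simp, by simp⟩
  add_mem' := by
    rintro y z ⟨r, hr, hd, h1, h2⟩ ⟨s, hs, hd', h1', h2'⟩
    refine ⟨r + s, add_nonneg hr hs, fun p hp => ?_, ?_, ?_⟩
    · by_cases h : r p = 0
      · exact hd' p fun h' => hp (by simp [h, h'])
      · exact hd p h
    · rw [map_add, h1, h1', Prod.fst_add]
    · rw [map_add, Prod.snd_add]
      exact add_le_add h2 h2'
  smul_mem' := by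
    rintro ⟨a, ha⟩ z ⟨r, hr, hd, h1, h2⟩
    refine ⟨a • r, fun p => mul_nonneg ha (hr p), fun p hp => hd p fun h => hp (by simp [h]), ?_, ?_⟩
    · rw [map_smul, h1]
      rfl
    · rw [map_smul]
      exact mul_le_mul_of_nonneg_left h2 ha

/-- Since the prior is relatively interior, the Riesz extension theorem provides a non-vertical
hyperplane that supports the net utility of a menu from above at its value. -/
theorem optimalSlopes_nonempty (P : PosteriorSeparable pref u p₀ ψ V) {M : ℕ}
    (τ : DomainChart ψ M) (F : Menu Ω X) : (optimalSlopes u p₀ ψ V τ F).Nonempty := by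
  have hψ := P.canonical.nonneg
  let f : ((Fin M → ℝ) × ℝ) →ₗ.[ℝ] ℝ :=
    { domain := LinearMap.ker (LinearMap.fst ℝ (Fin M → ℝ) ℝ)
      toFun := (LinearMap.snd ℝ (Fin M → ℝ) ℝ).comp (Submodule.subtype _) }
  have hmemK : ∀ (p : stdSimplex ℝ Ω) (a : ℝ), ψ p < ⊤ → 0 ≤ a →
      (a • (τ.T p.1 - τ.T p₀.1), a * (V F - (menuUtility u F p - (ψ p).toReal))) ∈
        netCone u p₀ ψ V τ F := by
    intro p a hp ha
    refine ⟨Finsupp.single p a, by simpa using ha, fun q hq => ?_, by simp, by simp⟩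
    obtain rfl : p = q := by
      by_contra hne
      exact hq (Finsupp.single_eq_of_ne' hne)
    exact hp
  have hnonneg : ∀ z : f.domain, (z : (Fin M → ℝ) × ℝ) ∈ netCone u p₀ ψ V τ F → 0 ≤ f z := by
    rintro ⟨⟨v, s⟩, hv⟩ ⟨r, hr, hd, h1, h2⟩
    obtain rfl : v = 0 := hv
    refine le_trans ?_ h2
    exact P.sum_net_le_of_sum_eq_zero τ F r.support r (fun p _ => hr p)
      (fun p hp => hd p (Finsupp.mem_support_iff.1 hp)) h1
  have hdense : ∀ y, ∃ z : f.domain, (z : (Fin M → ℝ) × ℝ) + y ∈ netCone u p₀ ψ V τ F := by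
    rintro ⟨v, s⟩
    obtain ⟨ε, hε, p, hp, hpv⟩ := τ.exists_mem_effDom_eq_add_smul P.canonical.prior_mem v
    refine ⟨⟨(0, ε⁻¹ * (V F - (menuUtility u F p - (ψ p).toReal)) - s), rfl⟩, ?_⟩
    have := hmemK p ε⁻¹ hp (inv_nonneg.2 hε.le)
    rw [hpv, smul_smul, inv_mul_cancel₀ hε.ne', one_smul] at this
    simpa using this
  obtain ⟨g, hgf, hgK⟩ := riesz_extension (netCone u p₀ ψ V τ F) f hnonneg hdense
  have hg1 : g (0, 1) = 1 := hgf ⟨(0, 1), rfl⟩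
  refine ⟨fun j => (g.comp (LinearMap.inl ℝ (Fin M → ℝ) ℝ)) (Pi.single j 1),
    (mem_optimalSlopes_iff hψ τ).2 fun p hp => ?_⟩
  rw [← linearMap_eq_dotProduct]
  have h1 := hgK _ (hmemK p 1 hp zero_le_one)
  have h2 : ∀ (v : Fin M → ℝ) (s : ℝ), g (v, s) = g (v, 0) + s := by
    intro v s
    have : (v, s) = (v, 0) + s • ((0, 1) : (Fin M → ℝ) × ℝ) := by simp
    rw [this, map_add, map_smul, hg1, smul_eq_mul, mul_one]
  rw [one_smul, one_mul, h2] at h1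
  simp only [LinearMap.comp_apply, LinearMap.inl_apply]
  linarith

/-- Two optimal slopes of `F` differ by a direction in which `ψ` is non-differentiable at all
posteriors of an optimal distribution. -/
theorem uhp_of_jdd (P : PosteriorSeparable pref u p₀ ψ V) (hJ : JDD p₀ ψ) : UHP u p₀ ψ V := by
  classical
  intro M τ F
  have hψ := P.canonical.nonneg
  obtain ⟨l, hl⟩ := P.optimalSlopes_nonempty τ F
  refine ⟨l, Set.eq_singleton_iff_unique_mem.2 ⟨hl, fun l' hl' => ?_⟩⟩
  by_contra hne
  obtain ⟨π, hπ, hsupp, hF⟩ := P.represents.exists_optimal_separable hψ F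
  have htight : ∀ l ∈ optimalSlopes u p₀ ψ V τ F, ∀ p ∈ π.weights.support,
      menuUtility u F p - (ψ p).toReal = l ⬝ᵥ (τ.T p.1 - τ.T p₀.1) + V F := by
    intro l hl p hp
    obtain ⟨x, hx⟩ := DomainChart.exists_dotProduct_eq τ.T l (τ.T p₀.1) (V F)
    have hle := (mem_optimalSlopes_iff hψ τ).1 hl
    rw [← hx]
    refine eq_of_integralReal_le (φ := fun p => menuUtility u F p - (ψ p).toReal)
      (χ := fun p => x ⬝ᵥ p.1) (fun p hp => ?_) ?_ hp
    · rw [hx]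
      exact hle p (hsupp p hp)
    · rw [integralReal_linear hπ, integralReal_sub, hF, hx]
      simp
  choose f hfF hf using exists_menuUtility_eq u F
  choose μ hμ using fun p => τ.exists_slope ⟨_, P.prior_mem_effDom⟩ (u ∘ f p)
  have hA : ∀ p : stdSimplex ℝ Ω, ψ p < ⊤ → p.1 ∈ affineSpan ℝ (effDom ψ) :=
    fun p hp => subset_affineSpan ℝ _ ⟨p, hp, rfl⟩
  have hsub : ∀ l ∈ optimalSlopes u p₀ ψ V τ F, ∀ p ∈ π.weights.support,
      μ p - l ∈ subdiff ψ τ p := by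
    intro l hl p hp
    rw [mem_subdiff_iff hψ τ (hsupp p hp)]
    intro q hq
    have h1 := htight l hl p hp
    have h2 := (mem_optimalSlopes_iff hψ τ).1 hl q hq
    have h3 := hμ p q.1 (hA q hq) p.1 (hA p (hsupp p hp))
    have h4 := le_menuUtility (u := u) (p := q) (hfF p)
    have h5 := hf p
    simp only [sub_dotProduct, dotProduct_sub] at h1 h2 h3 ⊢
    linarith
  let e := π.weights.support.equivFin
  refine hJ M τ ⟨l' - l, _, fun i => (e.symm i).1, sub_ne_zero.2 hne,
    fun i => hsupp _ (e.symm i).2, ?_, fun i => μ (e.symm i).1 - l', fun i =>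
      ⟨hsub l' hl' _ (e.symm i).2, ?_, ?_⟩⟩
  · have hmean : ∑ p ∈ π.weights.support, π.weights p • p.1 = p₀.1 := by
      ext ω
      simpa using hπ ω
    rw [← hmean]
    refine (convex_convexHull ℝ _).sum_mem (fun p _ => π.weights_nonneg p) π.total fun p hp => ?_
    exact subset_convexHull ℝ _ ⟨e ⟨p, hp⟩, by simp⟩
  · rw [sub_add_sub_cancel]
    exact hsub l hl _ (e.symm i).2
  · rw [sub_dotProduct]
    linarith [htight l hl _ (e.symm i).2, htight l' hl' _ (e.symm i).2]

end PosteriorSeparable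

/-! ### The measure of uncertainty revealed by a preference -/

section Revealed

variable {Ω X : Type*}

/-- The worthless gains: the utility differences `u ∘ f - u ∘ h` of acts such that adding `f` to
`{h}` does not improve it. -/
def worthlessGains (pref : Menu Ω X → Menu Ω X → Prop) (u : X → ℝ) : Set (Ω → ℝ) :=
  {x | ∃ f h : Ω → X, u ∘ f - u ∘ h = x ∧
    pref (Menu.single h) ((Menu.single h).union (Menu.single f))}

/-- The revealed measure of uncertainty: the support function of the set of worthless gains. It
is the least function that at every posterior outweighs each worthless gain. -/
noncomputable def revealedUncertainty [Fintype Ω] (pref : Menu Ω X → Menu Ω X → Prop) (u : X → ℝ)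
    (p : stdSimplex ℝ Ω) : EReal :=
  ⨆ x ∈ worthlessGains pref u, ((x ⬝ᵥ p.1 : ℝ) : EReal)

theorem le_revealedUncertainty [Fintype Ω] {pref : Menu Ω X → Menu Ω X → Prop} {u : X → ℝ}
    {x : Ω → ℝ} (hx : x ∈ worthlessGains pref u) (p : stdSimplex ℝ Ω) :
    ((x ⬝ᵥ p.1 : ℝ) : EReal) ≤ revealedUncertainty pref u p :=
  le_iSup₂ (f := fun x (_ : x ∈ worthlessGains pref u) => ((x ⬝ᵥ p.1 : ℝ) : EReal)) x hx

theorem revealedUncertainty_convex [Fintype Ω] (pref : Menu Ω X → Menu Ω X → Prop) (u : X → ℝ)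
    (p q r : stdSimplex ℝ Ω) (a b : ℝ) (ha : 0 ≤ a) (hb : 0 ≤ b) (hr : r.1 = a • p.1 + b • q.1) :
    revealedUncertainty pref u r ≤
      (a : EReal) * revealedUncertainty pref u p + (b : EReal) * revealedUncertainty pref u q := by
  refine iSup₂_le fun x hx => ?_
  rw [hr, dotProduct_add, dotProduct_smul, dotProduct_smul, smul_eq_mul, smul_eq_mul,
    EReal.coe_add, EReal.coe_mul, EReal.coe_mul]
  exact add_le_add
    (mul_le_mul_of_nonneg_left (le_revealedUncertainty hx p) (EReal.coe_nonneg.2 ha))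
    (mul_le_mul_of_nonneg_left (le_revealedUncertainty hx q) (EReal.coe_nonneg.2 hb))

end Revealed

theorem convex_effDom {Ω : Type*} [Fintype Ω] {ψ : stdSimplex ℝ Ω → EReal} (hψ : ∀ p, 0 ≤ ψ p)
    (h : ∀ (p q r : stdSimplex ℝ Ω) (a b : ℝ), 0 ≤ a → 0 ≤ b → r.1 = a • p.1 + b • q.1 →
      ψ r ≤ (a : EReal) * ψ p + (b : EReal) * ψ q) : Convex ℝ (effDom ψ) := by
  rintro _ ⟨p, hp, rfl⟩ _ ⟨q, hq, rfl⟩ a b ha hb hab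
  refine ⟨⟨a • p.1 + b • q.1, convex_stdSimplex ℝ Ω p.2 q.2 ha hb hab⟩, ?_, rfl⟩
  refine lt_of_le_of_lt (h p q _ a b ha hb rfl) ?_
  rw [← coe_toReal_of_nonneg (hψ p) hp, ← coe_toReal_of_nonneg (hψ q) hq, ← EReal.coe_mul,
    ← EReal.coe_mul, ← EReal.coe_add]
  exact EReal.coe_lt_top _

namespace Represents

variable {Ω X : Type*} [Fintype Ω] [MixtureSpace X] {pref : Menu Ω X → Menu Ω X → Prop}
  {u : X → ℝ} {p₀ : stdSimplex ℝ Ω} {c : feasible p₀ → EReal} {V : Menu Ω X → ℝ}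

/-- Whether a gain is worthless does not depend on the acts between which it is made. -/
theorem sub_mem_worthlessGains_iff (R : Represents pref u p₀ c V) (f h : Ω → X) :
    u ∘ f - u ∘ h ∈ worthlessGains pref u ↔
      V ((Menu.single h).union (Menu.single f)) ≤ V (Menu.single h) := by
  rw [← R.pref_iff]
  refine ⟨?_, fun hp => ⟨f, h, rfl, hp⟩⟩
  rintro ⟨f', h', heq, hp⟩
  rw [R.pref_iff] at hp ⊢
  have h1 := R.value_le_value_add (F := (Menu.single h).union (Menu.single f))
    (G := (Menu.single h').union (Menu.single f')) (u ∘ h - u ∘ h') fun p => by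
      have hh := le_menuUtility (u := u) (F := (Menu.single h').union (Menu.single f')) (p := p)
        (Menu.mem_union.2 (Or.inl (Menu.mem_single.2 rfl)))
      have hf := le_menuUtility (u := u) (F := (Menu.single h').union (Menu.single f')) (p := p)
        (Menu.mem_union.2 (Or.inr (Menu.mem_single.2 rfl)))
      have heq' := congrArg (· ⬝ᵥ p.1) heq
      simp only [sub_dotProduct] at heq' ⊢
      refine menuUtility_union_le ?_ ?_ <;> rw [menuUtility_single] <;> linarith
  have h2 := R.value_single_eq h h'
  rw [sub_dotProduct] at h1
  linarith

theorem zero_mem_worthlessGains (R : Represents pref u p₀ c V) :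
    (0 : Ω → ℝ) ∈ worthlessGains pref u := by
  obtain ⟨z, -⟩ := exists_act R.surjective (0 : Ω → ℝ)
  rw [← sub_self (u ∘ z), R.sub_mem_worthlessGains_iff]
  exact R.value_mono fun g hg => (Menu.mem_union.1 hg).elim id id

theorem dotProduct_prior_nonpos (R : Represents pref u p₀ c V) {x : Ω → ℝ}
    (hx : x ∈ worthlessGains pref u) : x ⬝ᵥ p₀.1 ≤ 0 := by
  obtain ⟨f, h, rfl, hp⟩ := hx
  rw [R.pref_iff] at hp
  have h1 := R.value_single_eq f h
  have h2 : V (Menu.single f) ≤ V ((Menu.single h).union (Menu.single f)) :=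
    R.value_single_le_of_mem (Menu.mem_union.2 (Or.inr (Menu.mem_single.2 rfl)))
  rw [sub_dotProduct]
  linarith

theorem revealedUncertainty_nonneg (R : Represents pref u p₀ c V) (p : stdSimplex ℝ Ω) :
    0 ≤ revealedUncertainty pref u p := by
  simpa using le_revealedUncertainty R.zero_mem_worthlessGains p

theorem revealedUncertainty_prior (R : Represents pref u p₀ c V) :
    revealedUncertainty pref u p₀ = 0 :=
  le_antisymm (iSup₂_le fun _ hx => EReal.coe_nonpos.2 (R.dotProduct_prior_nonpos hx))
    (R.revealedUncertainty_nonneg p₀)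

theorem dotProduct_nonpos_of_forall_nsmul (R : Represents pref u p₀ c V) {x : Ω → ℝ}
    (hx : ∀ n : ℕ, n • x ∈ worthlessGains pref u) {q : stdSimplex ℝ Ω}
    (hq : revealedUncertainty pref u q < ⊤) : x ⬝ᵥ q.1 ≤ 0 := by
  by_contra! hpos
  obtain ⟨n, hn⟩ := exists_lt_nsmul hpos (revealedUncertainty pref u q).toReal
  have h1 := le_revealedUncertainty (hx n) q
  rw [smul_dotProduct, ← coe_toReal_of_nonneg (R.revealedUncertainty_nonneg q) hq,
    EReal.coe_le_coe_iff] at h1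
  exact hn.not_ge h1

theorem neg_mem_worthlessGains (R : Represents pref u p₀ c V) {x : Ω → ℝ}
    (hx : x ∈ worthlessGains pref u) (h₀ : x ⬝ᵥ p₀.1 = 0) : -x ∈ worthlessGains pref u := by
  obtain ⟨f, h, rfl, hp⟩ := hx
  rw [R.pref_iff] at hp
  rw [neg_sub, R.sub_mem_worthlessGains_iff]
  have h1 := R.value_single_eq f h
  rw [sub_dotProduct] at h₀
  have h2 : V ((Menu.single f).union (Menu.single h)) ≤ V ((Menu.single h).union (Menu.single f)) :=
    R.value_mono fun g hg => Menu.mem_union.2 (Menu.mem_union.1 hg).symm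
  linarith

/-- If neither `-x` nor `y` improves on the zero act, then by IIA they do not do so jointly; hence
replacing `-x` by `y`, a gain of `x + y`, is worthless. -/
theorem add_mem_worthlessGains (R : Represents pref u p₀ c V) (hI : IIA pref) {x y : Ω → ℝ}
    (hx : x ∈ worthlessGains pref u) (h₀ : x ⬝ᵥ p₀.1 = 0) (hy : y ∈ worthlessGains pref u) :
    x + y ∈ worthlessGains pref u := by
  obtain ⟨z, hz⟩ := exists_act R.surjective (0 : Ω → ℝ)
  obtain ⟨a, ha⟩ := exists_act R.surjective (-x)
  obtain ⟨b, hb⟩ := exists_act R.surjective y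
  have h1 := (R.sub_mem_worthlessGains_iff a z).1 <| by
    rw [ha, hz, sub_zero]
    exact R.neg_mem_worthlessGains hx h₀
  have h2 := (R.sub_mem_worthlessGains_iff b z).1 <| by rwa [hb, hz, sub_zero]
  have h3 := R.value_union_le hI (fun g hg => Menu.mem_union.2 (Or.inl hg))
    (fun g hg => Menu.mem_union.2 (Or.inl hg)) h1 h2
  have h4 := R.value_single_eq a z
  rw [ha, hz, neg_dotProduct, zero_dotProduct, h₀] at h4
  have h5 : u ∘ b - u ∘ a = x + y := by rw [ha, hb, sub_neg_eq_add, add_comm]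
  rw [← h5, R.sub_mem_worthlessGains_iff]
  have h6 : V ((Menu.single a).union (Menu.single b)) ≤
      V (((Menu.single z).union (Menu.single a)).union ((Menu.single z).union (Menu.single b))) :=
    R.value_mono fun g hg => Menu.mem_union.2 <| (Menu.mem_union.1 hg).imp
      (fun h => Menu.mem_union.2 (Or.inr h)) (fun h => Menu.mem_union.2 (Or.inr h))
  linarith

/-- The worthless gains with prior mean zero form a group by IIA, so the uncertainty of a posterior
in the effective domain outweighs all their multiples only if they vanish there. -/
theorem dotProduct_eq_zero_of_mem (R : Represents pref u p₀ c V) (hI : IIA pref) {x : Ω → ℝ}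
    (hx : x ∈ worthlessGains pref u) (h₀ : x ⬝ᵥ p₀.1 = 0) {q : stdSimplex ℝ Ω}
    (hq : revealedUncertainty pref u q < ⊤) : x ⬝ᵥ q.1 = 0 := by
  have key : ∀ x : Ω → ℝ, x ∈ worthlessGains pref u → x ⬝ᵥ p₀.1 = 0 → x ⬝ᵥ q.1 ≤ 0 := by
    intro x hx h₀
    refine R.dotProduct_nonpos_of_forall_nsmul (fun n => ?_) hq
    induction n with
    | zero => simpa using R.zero_mem_worthlessGains
    | succ n ih =>
      rw [succ_nsmul']
      exact R.add_mem_worthlessGains hI hx h₀ ih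
  refine le_antisymm (key x hx h₀) ?_
  have := key (-x) (R.neg_mem_worthlessGains hx h₀) (by rw [neg_dotProduct, h₀, neg_zero])
  rw [neg_dotProduct] at this
  linarith

/-- IE bounds the net utility of `F` by that of its ignorance equivalent `h`. IIA makes the bound
tight on the support of an optimal distribution for `F`: no worthless gain over `h` has value when
added to `F`, so at the posteriors of that distribution it cannot beat the acts of `F`. Values are
normalized so that the act of utility zero has value zero. -/
theorem represents_revealedUncertainty (R : Represents pref u p₀ c V) (hI : IIA pref)
    (hE : IE pref) {z : Ω → X} (hz : u ∘ z = 0) :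
    Represents pref u p₀ (fun π => integralEReal (revealedUncertainty pref u) π.1)
      (fun F => V F - V (Menu.single z)) where
  affine := R.affine
  surjective := R.surjective
  cost_ne_bot π := ne_bot_of_le_ne_bot (by simp)
    (integralEReal_nonneg R.revealedUncertainty_nonneg π.1)
  pref_iff F G := by rw [R.pref_iff, sub_le_sub_iff_right]
  isMax F := by
    obtain ⟨h, hF₁, hF₂⟩ := hE F
    rw [R.indiff_iff] at hF₁ hF₂
    have hval : V F - V (Menu.single z) = (u ∘ h) ⬝ᵥ p₀.1 := by
      rw [← hF₁, R.value_single_eq h z, hz, zero_dotProduct]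
      ring
    have hle : ∀ p : stdSimplex ℝ Ω, ((menuUtility u F p - (u ∘ h) ⬝ᵥ p.1 : ℝ) : EReal) ≤
        revealedUncertainty pref u p := by
      intro p
      obtain ⟨f, hf, hfp⟩ := exists_menuUtility_eq u F p
      rw [hfp, ← sub_dotProduct]
      refine le_revealedUncertainty ((R.sub_mem_worthlessGains_iff f h).2 ?_) p
      rw [hF₁, hF₂]
      refine R.value_mono fun g hg => Menu.mem_union.2 ((Menu.mem_union.1 hg).symm.imp ?_ id)
      intro hg
      rwa [Menu.mem_single.1 hg]
    have hint : ∀ π ∈ feasible p₀, integralReal (fun p => menuUtility u F p - (u ∘ h) ⬝ᵥ p.1) π =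
        integralReal (menuUtility u F) π - (u ∘ h) ⬝ᵥ p₀.1 := fun π hπ => by
      rw [integralReal_sub, integralReal_linear hπ]
    rw [hval]
    constructor
    · obtain ⟨π, r, -, hπF, hπG⟩ := R.exists_optimal F
      have heq : ∀ p ∈ π.1.weights.support, revealedUncertainty pref u p =
          ((menuUtility u F p - (u ∘ h) ⬝ᵥ p.1 : ℝ) : EReal) := by
        intro p hp
        refine le_antisymm (iSup₂_le fun x hx => EReal.coe_le_coe_iff.2 ?_) (hle p)
        obtain ⟨f, hf⟩ := exists_act R.surjective (x + u ∘ h)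
        have hx' : V ((Menu.single h).union (Menu.single f)) ≤ V (Menu.single h) :=
          (R.sub_mem_worthlessGains_iff f h).1 (by rwa [hf, add_sub_cancel_right])
        -- the optimal distribution `π` for `F` stays feasible for the larger menu `G`, whose value
        -- is no higher, so `G` cannot do better than `F` at any posterior in the support of `π`
        set G := (F.union (Menu.single h)).union ((Menu.single h).union (Menu.single f))
        have hVG : V G ≤ V F := hF₁ ▸ R.value_union_le hI
          (fun g hg => Menu.mem_union.2 (Or.inr hg)) (fun g hg => Menu.mem_union.2 (Or.inl hg))
          (by rw [hF₁, hF₂]) hx'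
        have hFG : F.acts ⊆ G.acts := fun g hg =>
          Menu.mem_union.2 (Or.inl (Menu.mem_union.2 (Or.inl hg)))
        have hfG : f ∈ G.acts := Menu.mem_union.2 (Or.inr (Menu.mem_union.2 (Or.inr
          (Menu.mem_single.2 rfl))))
        have h1 : menuUtility u F p = menuUtility u G p :=
          eq_of_integralReal_le (φ := menuUtility u F) (χ := menuUtility u G)
            (fun p _ => menuUtility_mono hFG) (by linarith [hπG G]) hp
        have h2 := le_menuUtility (u := u) (p := p) hfG
        rw [hf, add_dotProduct] at h2
        linarith
      refine ⟨π, ?_⟩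
      simp only
      rw [integralEReal_congr heq, integralEReal_coe, hint _ π.2, ← EReal.coe_sub, sub_sub_cancel]
    · rintro _ ⟨π, rfl⟩
      have h1 := integralEReal_mono fun p (_ : p ∈ π.1.weights.support) => hle p
      rw [integralEReal_coe, hint _ π.2] at h1
      refine (EReal.sub_le_sub le_rfl h1).trans ?_
      rw [← EReal.coe_sub, sub_sub_cancel]

/-- If the prior were not relatively interior, some nonnegative nonzero gain on the effective domain
would have prior mean zero. Information with finite cost never reaches its positive part, so all its
multiples would be worthless. -/
theorem prior_mem_intrinsicInterior
    (R : Represents pref u p₀ (fun π => integralEReal (revealedUncertainty pref u) π.1) V) :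
    p₀.1 ∈ intrinsicInterior ℝ (effDom (revealedUncertainty pref u)) := by
  have hψ := R.revealedUncertainty_nonneg
  have h₀ := R.revealedUncertainty_prior
  have hmem : p₀.1 ∈ effDom (revealedUncertainty pref u) := ⟨p₀, by simp [h₀], rfl⟩
  obtain ⟨M, ⟨τ⟩⟩ := exists_domainChart _ ⟨_, hmem⟩
  by_contra hint
  obtain ⟨l, hl, _, ⟨q, hq, rfl⟩, hlq⟩ := τ.exists_supporting_slope
    (convex_effDom hψ (revealedUncertainty_convex pref u)) hmem hint
  obtain ⟨x, hx⟩ := DomainChart.exists_dotProduct_eq τ.T l (τ.T p₀.1) 0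
  have hx₀ : x ⬝ᵥ p₀.1 = 0 := by simpa using hx p₀
  rw [← add_zero (_ ⬝ᵥ _), ← hx] at hlq
  refine (R.dotProduct_nonpos_of_forall_nsmul (fun n => ?_) hq).not_gt hlq
  obtain ⟨z, hz⟩ := exists_act R.surjective (0 : Ω → ℝ)
  obtain ⟨f, hf⟩ := exists_act R.surjective (n • x)
  rw [← sub_zero (n • x), ← hz, ← hf, R.sub_mem_worthlessGains_iff,
    R.value_single_eq_dotProduct hψ h₀, hz, zero_dotProduct]
  obtain ⟨π, hπ, hsupp, hV⟩ := R.exists_optimal_separable hψ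
    ((Menu.single z).union (Menu.single f))
  have hnonneg : ∀ p ∈ π.weights.support, 0 ≤ x ⬝ᵥ p.1 := fun p hp => by
    rw [hx, add_zero]
    exact hl p.1 ⟨p, hsupp p hp, rfl⟩
  have hzero : ∀ p ∈ π.weights.support, 0 = x ⬝ᵥ p.1 := fun p hp =>
    eq_of_integralReal_le (φ := fun _ => 0) (χ := fun p => x ⬝ᵥ p.1) hnonneg
      (by rw [integralReal_linear hπ, hx₀]; simp [integralReal]) hp
  rw [← hV, ← integralReal_sub]
  refine (integralReal_mono (χ := fun _ => 0) fun p hp => ?_).trans (by simp [integralReal])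
  have hle : menuUtility u ((Menu.single z).union (Menu.single f)) p ≤ 0 := by
    refine menuUtility_union_le ?_ ?_ <;> rw [menuUtility_single]
    · rw [hz, zero_dotProduct]
    · rw [hf, smul_dotProduct, ← hzero p hp, smul_zero]
  linarith [EReal.toReal_nonneg (hψ p)]

/-- Suppose `ψ` is non-differentiable in the direction `δ` at `p₁, …, p_K`. The menu of tangents at
these points has value zero, and adding the zero act or the act `-δ` does not change this. By IIA
neither does adding both, so `-δ` is a worthless gain with prior mean zero. -/
theorem jdd_revealedUncertainty
    (R : Represents pref u p₀ (fun π => integralEReal (revealedUncertainty pref u) π.1) V)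
    (hI : IIA pref) : JDD p₀ (revealedUncertainty pref u) := by
  classical
  set ψ := revealedUncertainty pref u
  rintro M τ ⟨δ, K, p, hδ, hp, hp₀, l, hl⟩
  have hψ : ∀ p, 0 ≤ ψ p := R.revealedUncertainty_nonneg
  have h₀ : ψ p₀ = 0 := R.revealedUncertainty_prior
  rw [convexHull_eq] at hp₀
  obtain ⟨ι, t, w, y, hw, hsum, hy, hcm⟩ := hp₀
  rw [t.centerMass_eq_of_sum_1 y hsum] at hcm
  have : Nonempty (Fin K) := by
    obtain ⟨i, hi⟩ : t.Nonempty := by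
      by_contra h
      simp [Finset.not_nonempty_iff_eq_empty.1 h] at hsum
    exact ⟨(hy i hi).choose⟩
  have hk : ∀ i, ∃ k, i ∈ t → (p k).1 = y i := fun i => by
    by_cases hi : i ∈ t
    · exact (hy i hi).imp fun k hk _ => hk
    · exact ⟨Classical.arbitrary _, fun h => absurd h hi⟩
  choose k hk using hk
  -- the acts `z` of utility zero, `d` of slope `-δ`, and `f i` tangent to `ψ` at `p i`
  obtain ⟨z, hz⟩ := exists_act R.surjective (0 : Ω → ℝ)
  obtain ⟨x, hx⟩ := DomainChart.exists_dotProduct_eq τ.T (-δ) (τ.T p₀.1) 0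
  obtain ⟨d, hd⟩ := exists_act R.surjective x
  have hf : ∀ i, ∃ f : Ω → X, ∀ q : stdSimplex ℝ Ω,
      (u ∘ f) ⬝ᵥ q.1 = l i ⬝ᵥ (τ.T q.1 - τ.T (p i).1) + (ψ (p i)).toReal := fun i => by
    obtain ⟨x, hx⟩ := DomainChart.exists_dotProduct_eq τ.T (l i) (τ.T (p i).1) (ψ (p i)).toReal
    obtain ⟨f, rfl⟩ := exists_act R.surjective x
    exact ⟨f, hx⟩
  choose f hf using hf
  let F : Menu Ω X := ⟨Finset.univ.image f, Finset.univ_nonempty.image f⟩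
  have hFle : ∀ (q : stdSimplex ℝ Ω) (a : ℝ), (∀ i, (u ∘ f i) ⬝ᵥ q.1 ≤ a) →
      menuUtility u F q ≤ a := fun q a h => menuUtility_le fun g hg => by
    obtain ⟨i, -, rfl⟩ := Finset.mem_image.1 hg
    exact h i
  have hF : 0 ≤ V F := by
    refine le_trans (Finset.sum_nonneg fun i hi => mul_nonneg (hw i hi) ?_)
      (R.sum_net_le_value hψ F t w (fun i => p (k i)) hw hsum ?_ fun i _ => hp _)
    · have h1 := le_menuUtility (u := u) (F := F) (p := p (k i))
        (Finset.mem_image_of_mem f (Finset.mem_univ (k i)))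
      rw [hf, sub_self, dotProduct_zero, zero_add] at h1
      exact sub_nonneg.2 h1
    · rw [← hcm]
      exact Finset.sum_congr rfl fun i hi => by rw [hk i hi]
  have hFz : V (F.union (Menu.single z)) ≤ 0 := by
    rw [← zero_dotProduct p₀.1]
    refine R.value_le_of_net_le hψ 0 fun q hq => ?_
    rw [zero_dotProduct, sub_nonpos]
    refine menuUtility_union_le (hFle q _ fun i => ?_) ?_
    · rw [hf]
      linarith [(mem_subdiff_iff hψ τ (hp i)).1 (hl i).1 q hq]
    · rw [menuUtility_single, hz, zero_dotProduct]
      exact EReal.toReal_nonneg (hψ q)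
  have hx₀ : x ⬝ᵥ p₀.1 = 0 := by simpa using hx p₀
  have hFd : V (F.union (Menu.single d)) ≤ 0 := by
    rw [← hx₀]
    refine R.value_le_of_net_le hψ x fun q hq => ?_
    rw [sub_le_iff_le_add]
    refine menuUtility_union_le (hFle q _ fun i => ?_) ?_
    · -- `l i + δ` is a subgradient too, and `δ` is constant along `p i - p₀`
      have h1 := (mem_subdiff_iff hψ τ (hp i)).1 (hl i).2.1 q hq
      have h2 := (hl i).2.2
      rw [hf, hx]
      simp only [add_dotProduct, neg_dotProduct, dotProduct_sub] at h1 h2 ⊢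
      linarith
    · rw [menuUtility_single, hd]
      linarith [EReal.toReal_nonneg (hψ q)]
  have hunion := R.value_union_le hI (fun g hg => Menu.mem_union.2 (Or.inl hg))
    (fun g hg => Menu.mem_union.2 (Or.inl hg)) (hFz.trans hF) (hFd.trans hF)
  have hF' : V F ≤ 0 := (R.value_mono fun g hg => Menu.mem_union.2 (Or.inl hg)).trans hFz
  have hpair : V ((Menu.single z).union (Menu.single d)) ≤
      V ((F.union (Menu.single z)).union (F.union (Menu.single d))) :=
    R.value_mono fun g hg => Menu.mem_union.2 <| (Menu.mem_union.1 hg).imp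
      (fun h => Menu.mem_union.2 (Or.inr h)) (fun h => Menu.mem_union.2 (Or.inr h))
  have hxmem : x ∈ worthlessGains pref u := by
    rw [← sub_zero x, ← hz, ← hd, R.sub_mem_worthlessGains_iff,
      R.value_single_eq_dotProduct hψ h₀ z, hz, zero_dotProduct]
    linarith
  refine hδ (τ.eq_zero_of_dotProduct_eq_zero (p₀ := p₀.1) ?_)
  rintro _ ⟨q, hq, rfl⟩
  have := R.dotProduct_eq_zero_of_mem hI hxmem hx₀ hq
  rw [hx, neg_dotProduct, add_zero] at this
  linarith

end Represents

theorem RationallyInattentive.exists_posteriorSeparable {Ω X : Type*} [Fintype Ω] [MixtureSpace X]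
    {pref : Menu Ω X → Menu Ω X → Prop} (h : RationallyInattentive pref) (hI : IIA pref)
    (hE : IE pref) :
    ∃ (u : X → ℝ) (p₀ : stdSimplex ℝ Ω) (ψ : stdSimplex ℝ Ω → EReal) (V : Menu Ω X → ℝ),
      PosteriorSeparable pref u p₀ ψ V ∧ JDD p₀ ψ := by
  obtain ⟨u, p₀, c, V, R⟩ := h
  obtain ⟨z, hz⟩ := exists_act R.surjective (0 : Ω → ℝ)
  have R' := R.represents_revealedUncertainty hI hE hz
  exact ⟨u, p₀, revealedUncertainty pref u, _, ⟨R',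
    { convex := fun p q r a b ha hb _ hr => revealedUncertainty_convex pref u p q r a b ha hb hr
      grounded := R.revealedUncertainty_prior
      nonneg := R.revealedUncertainty_nonneg
      prior_mem := R'.prior_mem_intrinsicInterior }⟩, R'.jdd_revealedUncertainty hI⟩

theorem theorem1 {Ω X : Type*} [Fintype Ω] [MixtureSpace X]
    (pref : Menu Ω X → Menu Ω X → Prop) :
    List.TFAE [
      RationallyInattentive pref ∧ IIA pref ∧ IE pref,
      ∃ (u : X → ℝ) (p₀ : stdSimplex ℝ Ω) (ψ : stdSimplex ℝ Ω → EReal) (V : Menu Ω X → ℝ),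
        PosteriorSeparable pref u p₀ ψ V ∧ JDD p₀ ψ,
      ∃ (u : X → ℝ) (p₀ : stdSimplex ℝ Ω) (ψ : stdSimplex ℝ Ω → EReal) (V : Menu Ω X → ℝ),
        PosteriorSeparable pref u p₀ ψ V ∧ UHP u p₀ ψ V] := by
  tfae_have 1 → 2 := fun ⟨hR, hI, hE⟩ => hR.exists_posteriorSeparable hI hE
  tfae_have 2 → 3 := fun ⟨u, p₀, ψ, V, P, hJ⟩ => ⟨u, p₀, ψ, V, P, P.uhp_of_jdd hJ⟩
  tfae_have 3 → 1 := fun ⟨_, _, _, _, P, hU⟩ =>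
    ⟨P.rationallyInattentive, P.iia_of_uhp hU, P.ie_of_uhp hU⟩
  tfae_finish
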